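/- **Setting.** Let $\mathcal W,\mathcal X,\hat{\mathcal W}$ be measurable spaces, $P_W$ a probability measure (prior) on $\mathcal W$, $P_{X|W}$ a Markov kernel from $\mathcal W$ to $\mathcal X$, and $\ell:\mathcal W\times\hat{\mathcal W}\to[0,\infty)$ a measurable loss. The Bayesian risk is $R_B=\inf_\phi \mathbb E[\ell(W,\phi(X))]$, where $W\sim P_W$, $X\sim P_{X|W}$, and the infimum is over all measurable $\phi:\mathcal X\to\hat{\mathcal W}$. Let $\mathcal U$ be a measurable space, $P_{U|W,X}$ a Markov kernel from $\mathcal W\times\mathcal X$ to $\mathcal U$, $P_{WXU}$ the resulting joint law of $(W,X,U)$, $P_U$ the law of $U$, and $P_{W|U}$ a regular conditional distribution of $W$ given $U$ (a Markov kernel, assumed to exist). **Definitions.** - For probability measures $P,Q$ with densities $p,q$ with respect to a common dominating measure $m$, $D_\alpha(P\|Q)=\frac1{\alpha-1}\log\int p^\alpha q^{1-\alpha}\,dm$ for $\alpha>1$ (so $D_\alpha=\infty$ if $P\not\ll Q$), and $D_1$ is the Kullback–Leibler divergence. - $I_\alpha(W,X|U)=\inf_{Q_{X|U}} D_\alpha\big(P_{WXU}\,\big\|\,P_U\,P_{W|U}\,Q_{X|U}\big)$,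 the infimum being over all Markov kernels $Q_{X|U}$ from $\mathcal U$ to $\mathcal X$. - $L_{W|U}(u,\rho)=\sup_{\hat w\in\hat{\mathcal W}}P_{W|U=u}(\ell(W,\hat w)<\rho)$, assumed to be a $P_U$-almost everywhere measurable function of $u$, so that $\mathbb E_U[L_{W|U}(U,\rho)]$ is defined. - $\mathcal L(W\to X|U)=\sup_T\log\dfrac{\sup_{\hat t}\mathbb P(T=\hat t(X,U))}{\sup_{\tilde t}\mathbb P(T=\tilde t(U))}$, the conditional maximal leakage, where $T$ runs over all random variables with values in an arbitrary finite alphabet such that $T-W-X$ is a Markov chain conditionally on $U$, and $\hat t,\tilde t$ run over all measurable estimators. **Theorem.** For every such $U$ with kernel $P_{U|W,X}$, every $\rho>0$ and every real $\alpha\ge1$, $$R_B\ \ge\ \rho\left(1-\exp\left(\frac{\alpha-1}{\alpha}\Big(I_\alpha(W,X|U)+\log\mathbb E_U[L_{W|U}(U,\rho)]\Big)\right)\right),$$ and moreover, for every $\rho>0$ (the bound that corresponds to $\alpha\to\infty$), $$R_B\ \ge\ \rho\left(1-\exp\Big(\mathcal L(W\to X|U)+\log\mathbb E_U[L_{W|U}(U,\rho)]\Big)\right).$$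 Here $\log 0=-\infty$, $\exp(-\infty)=0$, $\exp(+\infty)=+\infty$, $0\cdot(\pm\infty)=0$, and each inequality is asserted whenever the sum inside its exponential is not of the indeterminate form $(+\infty)+(-\infty)$. -/

import Mathlib

open MeasureTheory ProbabilityTheory
open scoped ENNReal NNReal

noncomputable section

/-- The Rényi divergence `D_α(P‖Q)`: for `α ≠ 1` it is `(α - 1)⁻¹ log ∫ p^α q^(1-α) dm`, where `p`
and `q` are the densities of `P` and `Q` with respect to the dominating measure `m = P + Q`; for
`α = 1` it is the Kullback-Leibler divergence. With the conventions of `ℝ≥0∞` one has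
`p^α * q^(1-α) = ∞` where `p > 0`, `q = 0`, `α > 1`, so the value is `⊤` if `P` is not absolutely
continuous with respect to `Q` and `α > 1`. -/
def renyiDivergence {E : Type*} [MeasurableSpace E] (α : ℝ) (P Q : Measure E) : EReal :=
  if α = 1 then (InformationTheory.klDiv P Q : EReal)
  else (((α - 1)⁻¹ : ℝ) : EReal) *
    ENNReal.log (∫⁻ e, P.rnDeriv (P + Q) e ^ α * Q.rnDeriv (P + Q) e ^ (1 - α) ∂(P + Q))

/-- The Bayesian risk `R_B = inf_φ E[ℓ(W, φ(X))]` for the prior `π = P_W` and the family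
`P = (P_{X|W=w})_w`; the infimum is over all measurable estimators `φ`. -/
def bayesianRisk {𝓦 𝓧 𝓦' : Type*} [MeasurableSpace 𝓦] [MeasurableSpace 𝓧] [MeasurableSpace 𝓦']
    (π : Measure 𝓦) (P : Kernel 𝓦 𝓧) (ℓ : 𝓦 → 𝓦' → ℝ≥0) : ℝ≥0∞ :=
  ⨅ (φ : 𝓧 → 𝓦') (_ : Measurable φ), ∫⁻ p, (ℓ p.1 (φ p.2) : ℝ≥0∞) ∂(π ⊗ₘ P)

/-- The joint law of `(U, (W, X))` when `W ∼ π`, `X ∼ P(· | W)` and `U ∼ κ(· | W, X)`. -/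
def jointLaw {𝓦 𝓧 𝓤 : Type*} [MeasurableSpace 𝓦] [MeasurableSpace 𝓧] [MeasurableSpace 𝓤]
    (π : Measure 𝓦) (P : Kernel 𝓦 𝓧) (κ : Kernel (𝓦 × 𝓧) 𝓤) : Measure (𝓤 × (𝓦 × 𝓧)) :=
  ((π ⊗ₘ P) ⊗ₘ κ).map Prod.swap

/-- `η` is a regular conditional distribution `P_{W|U}` of `W` given `U`, where `μ` is the law of
`(U, (W, X))`: the law of `(U, W)` is `P_U(du) η(u, dw)`. -/
def IsCondLawOfParam {𝓦 𝓧 𝓤 : Type*} [MeasurableSpace 𝓦] [MeasurableSpace 𝓧] [MeasurableSpace 𝓤]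
    (μ : Measure (𝓤 × (𝓦 × 𝓧))) (η : Kernel 𝓤 𝓦) : Prop :=
  (μ.map (fun p => (p.1, p.2.1))).IsCondKernel η

/-- The conditional Sibson mutual information
`I_α(W, X | U) = inf_Q D_α(P_{WXU} ‖ P_{W|U} Q_{X|U} P_U)`, where `μ` is the law of `(U, (W, X))`,
`η = P_{W|U}` and `Q` runs over all Markov kernels from `𝓤` to `𝓧`. -/
def condSibson {𝓦 𝓧 𝓤 : Type*} [MeasurableSpace 𝓦] [MeasurableSpace 𝓧] [MeasurableSpace 𝓤]
    (α : ℝ) (μ : Measure (𝓤 × (𝓦 × 𝓧))) (η : Kernel 𝓤 𝓦) : EReal :=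
  ⨅ (Q : Kernel 𝓤 𝓧) (_ : IsMarkovKernel Q), renyiDivergence α μ (μ.fst ⊗ₘ (η ×ₖ Q))

/-- The conditional small-ball probability
`L_{W|U}(u, ρ) = sup_{w'} P_{W|U=u}(ℓ(W, w') < ρ)`, where `η = P_{W|U}`. -/
def condSmallBall {𝓦 𝓤 𝓦' : Type*} [MeasurableSpace 𝓦] [MeasurableSpace 𝓤]
    (η : Kernel 𝓤 𝓦) (ℓ : 𝓦 → 𝓦' → ℝ≥0) (ρ : ℝ) (u : 𝓤) : ℝ≥0∞ :=
  ⨆ w' : 𝓦', η u {w | (ℓ w w' : ℝ) < ρ}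

/-- The joint law of `((U, (W, X)), T)` when `(U, (W, X)) ∼ μ` and `T` is drawn from `K(· | U, W)`.
These are exactly the joint laws for which `T - W - X` is a Markov chain given `U`. -/
def secretLaw {𝓦 𝓧 𝓤 : Type*} [MeasurableSpace 𝓦] [MeasurableSpace 𝓧] [MeasurableSpace 𝓤]
    (μ : Measure (𝓤 × (𝓦 × 𝓧))) {n : ℕ} (K : Kernel (𝓤 × 𝓦) (Fin n)) :
    Measure ((𝓤 × (𝓦 × 𝓧)) × Fin n) :=
  μ ⊗ₘ K.comap (fun p => (p.1, p.2.1)) (by fun_prop)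

/-- The conditional maximal leakage
`L(W → X | U) = sup_T log (P(T = T̂(X, U)) / P(T = T̃(U)))`, where `μ` is the law of `(U, (W, X))`,
`T` runs over all random variables with values in an arbitrary finite alphabet for which
`T - W - X` is a Markov chain given `U`, and `T̂`, `T̃` are optimal estimators of `T` given `(X, U)`
and given `U`: the two probabilities are the suprema over all measurable estimators. -/
def condMaxLeakage {𝓦 𝓧 𝓤 : Type*} [MeasurableSpace 𝓦] [MeasurableSpace 𝓧] [MeasurableSpace 𝓤]
    (μ : Measure (𝓤 × (𝓦 × 𝓧))) : EReal :=
  ⨆ (n : ℕ) (K : Kernel (𝓤 × 𝓦) (Fin n)) (_ : IsMarkovKernel K),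
    ENNReal.log
      ((⨆ (t : 𝓧 × 𝓤 → Fin n) (_ : Measurable t),
          secretLaw μ K {p | p.2 = t (p.1.2.2, p.1.1)}) /
        (⨆ (t : 𝓤 → Fin n) (_ : Measurable t),
          secretLaw μ K {p | p.2 = t p.1.1}))

end

/-!
By Markov's inequality the risk of an estimator `φ` is at least `ρ (1 - ℙ(ℓ(W, φ(X)) < ρ))`, so it
suffices to bound the probability of the small-loss event `S`. Given `U = u`, each section of `S`
over a value of `X` has `P_{W|U=u}`-probability at most `L_{W|U}(u, ρ)`.

Hence `S` has probability at most `𝔼[L_{W|U}(U, ρ)]` under `P_U P_{W|U} Q_{X|U}` for every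
`Q_{X|U}`, and Hölder's inequality transfers this bound to `P_{WXU}` at the cost of the Rényi
divergence.

For the leakage bound suppose first that `S` has only `N` distinct sections. Let the secret `T` name
the section `s` with probability `1 / N` when `W ∈ s`, the remaining mass being spread over many
letters of negligible probability. Then the section at the observed `X` is a guess of `T` that is
correct with probability `ℙ(S) / N`, whereas a guess based on `U` alone succeeds with probability at
most about `𝔼[L_{W|U}(U, ρ)] / N`. A general `S` is approximated by such sets, simultaneously under
the law of `((X, U), W)` and under the law that makes `X` and `W` conditionally independent given
`U`; the second approximation controls how often a section of the approximating set exceeds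
`L_{W|U}`.
-/

open Filter
open scoped symmDiff Topology

section ChangeOfMeasure

/-- The Hellinger integral `∫ p^α q^(1-α) dm` of order `α`, whose logarithm defines the Rényi
divergence; the dominating measure is `m = P + Q`. -/
noncomputable def hellingerIntegral {E : Type*} [MeasurableSpace E] (α : ℝ) (P Q : Measure E) :
    ℝ≥0∞ :=
  ∫⁻ e, P.rnDeriv (P + Q) e ^ α * Q.rnDeriv (P + Q) e ^ (1 - α) ∂(P + Q)

theorem renyiDivergence_of_ne_one {E : Type*} [MeasurableSpace E] {α : ℝ} (hα : α ≠ 1)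
    (P Q : Measure E) :
    renyiDivergence α P Q = ((α - 1)⁻¹ : ℝ) * ENNReal.log (hellingerIntegral α P Q) :=
  if_neg hα

theorem le_rpow_inv_mul_rpow_of_ne_top {α : ℝ} (hα : 1 < α) {p q : ℝ≥0∞} (hq : q ≠ ⊤)
    (hpq : p ^ α * q ^ (1 - α) ≠ ⊤) :
    p ≤ (p ^ α * q ^ (1 - α)) ^ α⁻¹ * q ^ ((α - 1) / α) := by
  have hα0 : 0 < α := by linarith
  rcases eq_or_ne q 0 with rfl | hq0
  · rw [ENNReal.zero_rpow_of_neg (by linarith)] at hpq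
    have hp : p = 0 := by
      by_contra hp
      exact hpq (ENNReal.mul_top (by simp [ENNReal.rpow_eq_zero_iff, hp, hα0.le]))
    simp [hp]
  · have hexp : (1 - α) * α⁻¹ + (α - 1) / α = 0 := by ring
    rw [ENNReal.mul_rpow_of_nonneg _ _ (by positivity), ← ENNReal.rpow_mul,
      ← ENNReal.rpow_mul, mul_assoc, ← ENNReal.rpow_add _ _ hq0 hq,
      mul_inv_cancel₀ hα0.ne', ENNReal.rpow_one, hexp, ENNReal.rpow_zero, mul_one]

theorem measure_le_hellingerIntegral_rpow_mul_rpow {E : Type*} [MeasurableSpace E] {α : ℝ}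
    (hα : 1 < α) (P Q : Measure E) [SigmaFinite P] [SigmaFinite Q]
    (hJ : hellingerIntegral α P Q ≠ ⊤) (S : Set E) :
    P S ≤ hellingerIntegral α P Q ^ α⁻¹ * Q S ^ ((α - 1) / α) := by
  have hα0 : 0 < α := by linarith
  have hP : P ≪ P + Q := Measure.AbsolutelyContinuous.rfl.add_right Q
  have hQ : Q ≪ P + Q := by
    rw [add_comm]
    exact Measure.AbsolutelyContinuous.rfl.add_right P
  set m := P + Q
  set p := P.rnDeriv m
  set q := Q.rnDeriv m
  have hq : Measurable q := Measure.measurable_rnDeriv _ _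
  have hpq : Measurable fun e => p e ^ α * q e ^ (1 - α) :=
    ((Measure.measurable_rnDeriv _ _).pow_const _).mul (hq.pow_const _)
  have hpointwise : ∀ᵐ e ∂m, p e ≤ (p e ^ α * q e ^ (1 - α)) ^ α⁻¹ * q e ^ ((α - 1) / α) := by
    filter_upwards [ae_lt_top hpq hJ, Measure.rnDeriv_lt_top Q m] with e he hqe
    exact le_rpow_inv_mul_rpow_of_ne_top hα hqe.ne he.ne
  calc P S = ∫⁻ e in S, p e ∂m := (Measure.setLIntegral_rnDeriv hP S).symm
    _ ≤ ∫⁻ e in S, (p e ^ α * q e ^ (1 - α)) ^ α⁻¹ * q e ^ ((α - 1) / α) ∂m :=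
        lintegral_mono_ae (ae_restrict_of_ae hpointwise)
    _ ≤ (∫⁻ e in S, p e ^ α * q e ^ (1 - α) ∂m) ^ α⁻¹ * (∫⁻ e in S, q e ∂m) ^ ((α - 1) / α) :=
        ENNReal.lintegral_mul_norm_pow_le hpq.aemeasurable hq.aemeasurable (by positivity)
          (div_nonneg (by linarith) hα0.le) (by field_simp; ring)
    _ ≤ hellingerIntegral α P Q ^ α⁻¹ * Q S ^ ((α - 1) / α) := by
        rw [Measure.setLIntegral_rnDeriv hQ S]
        gcongr
        exact setLIntegral_le_lintegral _ _

theorem log_measure_le_mul_renyiDivergence_add_log {E : Type*} [MeasurableSpace E] {α : ℝ}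
    (hα : 1 < α) (P Q : Measure E) [SigmaFinite P] [SigmaFinite Q] {S : Set E} {y : ℝ≥0∞}
    (hy : Q S ≤ y) (h : renyiDivergence α P Q ≠ ⊤ ∨ y ≠ 0) :
    ENNReal.log (P S) ≤ ((α - 1) / α : ℝ) * (renyiDivergence α P Q + ENNReal.log y) := by
  have hα0 : 0 < α := by linarith
  have hα1 : 0 < α - 1 := by linarith
  have hc : 0 < (α - 1) / α := div_pos hα1 hα0
  rw [renyiDivergence_of_ne_one hα.ne'] at h ⊢
  rcases eq_or_ne (hellingerIntegral α P Q) ⊤ with hJ | hJ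
  · rw [hJ, ENNReal.log_top, EReal.coe_mul_top_of_pos (inv_pos.2 hα1)] at h ⊢
    have hy0 : y ≠ 0 := by simpa using h
    rw [EReal.top_add_of_ne_bot (by simpa using hy0), EReal.coe_mul_top_of_pos hc]
    exact le_top
  · have hPS : P S ≤ hellingerIntegral α P Q ^ α⁻¹ * y ^ ((α - 1) / α) :=
      (measure_le_hellingerIntegral_rpow_mul_rpow hα P Q hJ S).trans (by gcongr)
    have hexp : (α - 1) / α * (α - 1)⁻¹ = α⁻¹ := by field_simp
    refine (ENNReal.log_le_log hPS).trans_eq ?_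
    rw [ENNReal.log_mul_add, ENNReal.log_rpow, ENNReal.log_rpow,
      EReal.left_distrib_of_nonneg_of_ne_top (by exact_mod_cast hc.le) (EReal.coe_ne_top _),
      ← mul_assoc, ← EReal.coe_mul, hexp]

end ChangeOfMeasure

section Sibson

variable {𝓦 𝓧 𝓤 : Type*} [MeasurableSpace 𝓦] [MeasurableSpace 𝓧] [MeasurableSpace 𝓤]

theorem le_coe_mul_iInf_add {ι : Sort*} {c : ℝ} (hc : 0 < c) {a b : EReal} {f : ι → EReal}
    (hb : b ≠ ⊥) (hb' : b ≠ ⊤) (h : ∀ i, a ≤ c * (f i + b)) : a ≤ c * ((⨅ i, f i) + b) := by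
  have hc' : (0 : EReal) < c := by exact_mod_cast hc
  have hiff (z : EReal) : a ≤ c * (z + b) ↔ a / c - b ≤ z := by
    rw [EReal.sub_le_iff_le_add (.inl hb) (.inl hb'),
      EReal.div_le_iff_le_mul hc' (EReal.coe_ne_top _)]
  rw [hiff]
  exact le_iInf fun i => (hiff _).1 (h i)

theorem compProd_prod_le_lintegral_of_section_le (m : Measure 𝓤) [SFinite m] (η : Kernel 𝓤 𝓦)
    [IsSFiniteKernel η] (Q : Kernel 𝓤 𝓧) [IsMarkovKernel Q] {S : Set (𝓤 × (𝓦 × 𝓧))}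
    (hS : MeasurableSet S) {L : 𝓤 → ℝ≥0∞}
    (hSL : ∀ᵐ u ∂m, ∀ x, η u {w | (u, (w, x)) ∈ S} ≤ L u) :
    (m ⊗ₘ (η ×ₖ Q)) S ≤ ∫⁻ u, L u ∂m := by
  rw [Measure.compProd_apply hS]
  refine lintegral_mono_ae ?_
  filter_upwards [hSL] with u hu
  rw [Kernel.prod_apply, Measure.prod_apply_symm (measurable_prodMk_left hS)]
  calc ∫⁻ x, η u {w | (u, (w, x)) ∈ S} ∂Q u ≤ ∫⁻ _, L u ∂Q u := lintegral_mono hu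
    _ = L u := by simp

theorem log_measure_le_mul_condSibson_add_log (μ : Measure (𝓤 × (𝓦 × 𝓧))) [IsFiniteMeasure μ]
    (η : Kernel 𝓤 𝓦) [IsMarkovKernel η] {α : ℝ} (hα : 1 < α) {S : Set (𝓤 × (𝓦 × 𝓧))} {y : ℝ≥0∞}
    (hytop : y ≠ ⊤)
    (hy : ∀ Q : Kernel 𝓤 𝓧, IsMarkovKernel Q → (μ.fst ⊗ₘ (η ×ₖ Q)) S ≤ y)
    (h : condSibson α μ η ≠ ⊤ ∨ y ≠ 0) :
    ENNReal.log (μ S) ≤ ((α - 1) / α : ℝ) * (condSibson α μ η + ENNReal.log y) := by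
  rcases eq_or_ne y 0 with rfl | hy0
  · obtain ⟨Q, hQ, hD⟩ : ∃ Q : Kernel 𝓤 𝓧, ∃ _ : IsMarkovKernel Q,
        renyiDivergence α μ (μ.fst ⊗ₘ (η ×ₖ Q)) ≠ ⊤ := by
      simpa [condSibson] using h
    have hbound := log_measure_le_mul_renyiDivergence_add_log hα μ _ (hy Q hQ) (.inl hD)
    rwa [ENNReal.log_zero, EReal.add_bot] at hbound ⊢
  · rw [condSibson, iInf_subtype']
    refine le_coe_mul_iInf_add (div_pos (by linarith) (by linarith)) (by simpa using hy0)
      (by simpa using hytop) ?_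
    rintro ⟨Q, hQ⟩
    exact log_measure_le_mul_renyiDivergence_add_log hα μ _ (hy Q hQ) (.inr hy0)

theorem measure_le_exp_condSibson_add_log (μ : Measure (𝓤 × (𝓦 × 𝓧))) [IsProbabilityMeasure μ]
    (η : Kernel 𝓤 𝓦) [IsMarkovKernel η] {α : ℝ} (hα : 1 ≤ α) {S : Set (𝓤 × (𝓦 × 𝓧))}
    (hS : MeasurableSet S) {L : 𝓤 → ℝ≥0∞} (hLtop : ∫⁻ u, L u ∂μ.fst ≠ ⊤)
    (hSL : ∀ᵐ u ∂μ.fst, ∀ x, η u {w | (u, (w, x)) ∈ S} ≤ L u)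
    (h : condSibson α μ η ≠ ⊤ ∨ ∫⁻ u, L u ∂μ.fst ≠ 0) :
    μ S ≤ EReal.exp (((α - 1) / α : ℝ) *
      (condSibson α μ η + ENNReal.log (∫⁻ u, L u ∂μ.fst))) := by
  rcases hα.eq_or_lt with rfl | hα
  · simpa using prob_le_one
  · rw [← ENNReal.log_le_log_iff, EReal.log_exp]
    exact log_measure_le_mul_condSibson_add_log μ η hα hLtop
      (fun Q _ => compProd_prod_le_lintegral_of_section_le μ.fst η Q hS hSL) h

end Sibson

section Leakage

variable {𝓦 𝓧 𝓤 : Type*} [MeasurableSpace 𝓦] [MeasurableSpace 𝓧] [MeasurableSpace 𝓤]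

theorem exists_isMarkovKernel_singleton_eq {E ι : Type*} [MeasurableSpace E] [Fintype ι]
    [MeasurableSpace ι] [MeasurableSingletonClass ι] {g : ι → E → ℝ≥0∞}
    (hg : ∀ i, Measurable (g i)) (hsum : ∀ a, ∑ i, g i a = 1) :
    ∃ K : Kernel E ι, IsMarkovKernel K ∧ ∀ a i, K a {i} = g i a := by
  have hgm : Measurable (Function.uncurry fun a i => g i a) :=
    measurable_from_prod_countable_left hg
  refine ⟨(Kernel.const E Measure.count).withDensity fun a i => g i a, ⟨fun a => ⟨?_⟩⟩,
    fun a i => ?_⟩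
  · rw [Kernel.withDensity_apply' _ hgm, Kernel.const_apply, setLIntegral_univ, lintegral_count,
      tsum_fintype, hsum]
  · rw [Kernel.withDensity_apply' _ hgm, Kernel.const_apply, lintegral_singleton,
      Measure.count_singleton, mul_one]

theorem secretLaw_setOf_snd_eq (μ : Measure (𝓤 × (𝓦 × 𝓧))) [SFinite μ] {n : ℕ}
    (K : Kernel (𝓤 × 𝓦) (Fin n)) [IsSFiniteKernel K] {f : 𝓤 × (𝓦 × 𝓧) → Fin n}
    (hf : Measurable f) :
    secretLaw μ K {p | p.2 = f p.1} = ∫⁻ p, K (p.1, p.2.1) {f p} ∂μ := by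
  have hS : MeasurableSet {p : (𝓤 × (𝓦 × 𝓧)) × Fin n | p.2 = f p.1} :=
    measurableSet_eq_fun measurable_snd (hf.comp measurable_fst)
  rw [secretLaw, Measure.compProd_apply hS]
  rfl

theorem IsCondLawOfParam.lintegral_eq {μ : Measure (𝓤 × (𝓦 × 𝓧))} [SFinite μ]
    {η : Kernel 𝓤 𝓦} [IsSFiniteKernel η] (hη : IsCondLawOfParam μ η) {f : 𝓤 × 𝓦 → ℝ≥0∞}
    (hf : Measurable f) :
    ∫⁻ p, f (p.1, p.2.1) ∂μ = ∫⁻ u, ∫⁻ w, f (u, w) ∂(η u) ∂μ.fst := by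
  have hproj : Measurable fun p : 𝓤 × (𝓦 × 𝓧) => (p.1, p.2.1) := by fun_prop
  have hfst : (μ.map fun p => (p.1, p.2.1)).fst = μ.fst := by
    rw [Measure.fst, Measure.map_map measurable_fst hproj]
    rfl
  have hdisintegrate := hη.disintegrate
  rw [hfst] at hdisintegrate
  rw [← lintegral_map hf hproj, ← hdisintegrate, Measure.lintegral_compProd hf]

theorem iSup_secretLaw_le_exp_condMaxLeakage_mul {μ : Measure (𝓤 × (𝓦 × 𝓧))} [IsFiniteMeasure μ]
    (hC : condMaxLeakage μ ≠ ⊤) {n : ℕ} (K : Kernel (𝓤 × 𝓦) (Fin n)) [IsMarkovKernel K] :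
    (⨆ (t : 𝓧 × 𝓤 → Fin n) (_ : Measurable t),
        secretLaw μ K {p | p.2 = t (p.1.2.2, p.1.1)}) ≤
      EReal.exp (condMaxLeakage μ) *
        ⨆ (t : 𝓤 → Fin n) (_ : Measurable t), secretLaw μ K {p | p.2 = t p.1.1} := by
  have hfin : IsFiniteMeasure (secretLaw μ K) := by
    unfold secretLaw
    infer_instance
  have hne_top : (⨆ (t : 𝓤 → Fin n) (_ : Measurable t), secretLaw μ K {p | p.2 = t p.1.1}) ≠ ⊤ :=
    ne_top_of_le_ne_top (measure_ne_top (secretLaw μ K) Set.univ)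
      (iSup₂_le fun _ _ => measure_mono (Set.subset_univ _))
  rw [← ENNReal.div_le_iff_le_mul (.inr (by simpa using hC)) (.inl hne_top),
    ← ENNReal.log_le_log_iff, EReal.log_exp]
  exact le_iSup_of_le n (le_iSup_of_le K (le_iSup_of_le inferInstance le_rfl))

theorem lintegral_guess_le_of_sum_eq_one {μ : Measure (𝓤 × (𝓦 × 𝓧))} [IsFiniteMeasure μ]
    {η : Kernel 𝓤 𝓦} [IsSFiniteKernel η] (hη : IsCondLawOfParam μ η)
    (hC : condMaxLeakage μ ≠ ⊤) {ι : Type*} [Fintype ι] {g : ι → 𝓤 × 𝓦 → ℝ≥0∞}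
    (hg : ∀ i, Measurable (g i)) (hsum : ∀ a, ∑ i, g i a = 1) (t : SimpleFunc (𝓧 × 𝓤) ι)
    {b : 𝓤 → ℝ≥0∞} (hb : ∀ i u, ∫⁻ w, g i (u, w) ∂(η u) ≤ b u) :
    ∫⁻ p, g (t (p.2.2, p.1)) (p.1, p.2.1) ∂μ ≤
      EReal.exp (condMaxLeakage μ) * ∫⁻ u, b u ∂μ.fst := by
  let e := Fintype.equivFin ι
  obtain ⟨K, hK, hKg⟩ := exists_isMarkovKernel_singleton_eq (g := fun j => g (e.symm j))
    (fun j => hg _) (fun a => (Equiv.sum_comp e.symm fun i => g i a).trans (hsum a))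
  have hsource : ∫⁻ p, g (t (p.2.2, p.1)) (p.1, p.2.1) ∂μ ≤
      ⨆ (s : 𝓧 × 𝓤 → Fin (Fintype.card ι)) (_ : Measurable s),
        secretLaw μ K {p | p.2 = s (p.1.2.2, p.1.1)} := by
    refine le_trans (le_of_eq ?_) (le_iSup₂ _ (t.map e).measurable)
    rw [secretLaw_setOf_snd_eq μ K (f := fun p => (t.map e) (p.2.2, p.1))
      ((t.map e).measurable.comp (by fun_prop))]
    simp [hKg]
  have hblind : (⨆ (s : 𝓤 → Fin (Fintype.card ι)) (_ : Measurable s),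
      secretLaw μ K {p | p.2 = s p.1.1}) ≤ ∫⁻ u, b u ∂μ.fst := by
    refine iSup₂_le fun s hs => ?_
    have hguncurry : Measurable fun q : Fin (Fintype.card ι) × (𝓤 × 𝓦) => g (e.symm q.1) q.2 :=
      measurable_from_prod_countable_right fun j => hg (e.symm j)
    have hgs : Measurable fun q : 𝓤 × 𝓦 => g (e.symm (s q.1)) q :=
      hguncurry.comp ((hs.comp measurable_fst).prodMk measurable_id)
    rw [secretLaw_setOf_snd_eq μ K (f := fun p => s p.1) (by fun_prop)]
    simp only [hKg]
    rw [hη.lintegral_eq hgs]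
    exact lintegral_mono fun u => hb (e.symm (s u)) u
  exact hsource.trans <| (iSup_secretLaw_le_exp_condMaxLeakage_mul hC K).trans (by gcongr)

theorem lintegral_guess_le_of_sum_le_one {μ : Measure (𝓤 × (𝓦 × 𝓧))} [IsFiniteMeasure μ]
    {η : Kernel 𝓤 𝓦} [IsMarkovKernel η] (hη : IsCondLawOfParam μ η)
    (hC : condMaxLeakage μ ≠ ⊤) {ι : Type*} [Fintype ι] {g : ι → 𝓤 × 𝓦 → ℝ≥0∞}
    (hg : ∀ i, Measurable (g i)) (hsum : ∀ a, ∑ i, g i a ≤ 1) (t : SimpleFunc (𝓧 × 𝓤) ι)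
    {b : 𝓤 → ℝ≥0∞} (hb : ∀ i u, ∫⁻ w, g i (u, w) ∂(η u) ≤ b u) :
    ∫⁻ p, g (t (p.2.2, p.1)) (p.1, p.2.1) ∂μ ≤
      EReal.exp (condMaxLeakage μ) * ∫⁻ u, b u ∂μ.fst := by
  set C := EReal.exp (condMaxLeakage μ)
  have hCtop : C ≠ ⊤ := by simpa [C] using hC
  -- Split the missing mass among `M` extra letters, so that guessing one of them gains little.
  have hpadded (M : ℕ) (hM : M ≠ 0) : ∫⁻ p, g (t (p.2.2, p.1)) (p.1, p.2.1) ∂μ ≤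
      C * (∫⁻ u, b u ∂μ.fst + (M : ℝ≥0∞)⁻¹ * μ.fst Set.univ) := by
    let g' : ι ⊕ Fin M → 𝓤 × 𝓦 → ℝ≥0∞ :=
      Sum.elim g fun _ a => (1 - ∑ i, g i a) * (M : ℝ≥0∞)⁻¹
    have hg' : ∀ i, Measurable (g' i) := by
      rintro (i | _)
      · exact hg i
      · exact (measurable_const.sub (Finset.measurable_sum _ fun i _ => hg i)).mul_const _
    have hsum' (a : 𝓤 × 𝓦) : ∑ i, g' i a = 1 := by
      simp only [g', Fintype.sum_sum_type, Sum.elim_inl, Sum.elim_inr, Finset.sum_const,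
        Finset.card_univ, Fintype.card_fin, nsmul_eq_mul]
      rw [mul_left_comm, ENNReal.mul_inv_cancel (by simpa using hM) (by simp), mul_one,
        add_tsub_cancel_of_le (hsum a)]
    have hb' : ∀ i u, ∫⁻ w, g' i (u, w) ∂(η u) ≤ b u + (M : ℝ≥0∞)⁻¹ := by
      rintro (i | j) u
      · exact (hb i u).trans le_self_add
      · calc ∫⁻ w, g' (Sum.inr j) (u, w) ∂(η u) ≤ ∫⁻ _, (M : ℝ≥0∞)⁻¹ ∂(η u) :=
              lintegral_mono fun w => mul_le_of_le_one_left' tsub_le_self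
          _ ≤ b u + (M : ℝ≥0∞)⁻¹ := by simp
    simpa [g', lintegral_add_right] using
      lintegral_guess_le_of_sum_eq_one hη hC hg' hsum' (t.map Sum.inl) hb'
  have hlim : Tendsto (fun M : ℕ => C * (∫⁻ u, b u ∂μ.fst + (M : ℝ≥0∞)⁻¹ * μ.fst Set.univ))
      atTop (𝓝 (C * (∫⁻ u, b u ∂μ.fst + 0 * μ.fst Set.univ))) :=
    ENNReal.Tendsto.const_mul (tendsto_const_nhds.add (ENNReal.Tendsto.mul_const
      ENNReal.tendsto_inv_nat_nhds_zero (.inr (measure_ne_top _ _)))) (.inr hCtop)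
  rw [zero_mul, add_zero] at hlim
  exact ge_of_tendsto hlim ((eventually_ne_atTop 0).mono hpadded)

theorem lintegral_guess_le_of_le_one {μ : Measure (𝓤 × (𝓦 × 𝓧))} [IsFiniteMeasure μ]
    {η : Kernel 𝓤 𝓦} [IsMarkovKernel η] (hη : IsCondLawOfParam μ η)
    (hC : condMaxLeakage μ ≠ ⊤) {ι : Type*} {g : ι → 𝓤 × 𝓦 → ℝ≥0∞}
    (hg : ∀ i, Measurable (g i)) (hg1 : ∀ i a, g i a ≤ 1) (t : SimpleFunc (𝓧 × 𝓤) ι)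
    {b : 𝓤 → ℝ≥0∞} (hb : ∀ i u, ∫⁻ w, g i (u, w) ∂(η u) ≤ b u) :
    ∫⁻ p, g (t (p.2.2, p.1)) (p.1, p.2.1) ∂μ ≤
      EReal.exp (condMaxLeakage μ) * ∫⁻ u, b u ∂μ.fst := by
  rcases isEmpty_or_nonempty (𝓧 × 𝓤) with hempty | ⟨⟨q₀⟩⟩
  · have : IsEmpty (𝓤 × (𝓦 × 𝓧)) := ⟨fun p => hempty.false (p.2.2, p.1)⟩
    simp [lintegral_of_isEmpty]
  set N : ℝ≥0∞ := (t.range.card : ℝ≥0∞)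
  have hN0 : N ≠ 0 := by
    simpa [N] using Finset.ne_empty_of_mem (t.mem_range_self q₀)
  have hNtop : N ≠ ⊤ := by simp [N]
  let t' : SimpleFunc (𝓧 × 𝓤) t.range :=
    { toFun := fun q => ⟨t q, t.mem_range_self q⟩
      measurableSet_fiber' := fun i => by
        simpa [Set.preimage, Subtype.ext_iff] using t.measurableSet_fiber i
      finite_range' := Set.toFinite _ }
  have hsum (a : 𝓤 × 𝓦) : ∑ i : t.range, N⁻¹ * g i a ≤ 1 := by
    calc ∑ i : t.range, N⁻¹ * g i a ≤ ∑ _i : t.range, N⁻¹ :=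
          Finset.sum_le_sum fun i _ => mul_le_of_le_one_right' (hg1 i a)
      _ = 1 := by simp [N, ENNReal.mul_inv_cancel hN0 hNtop]
  have hscaled := lintegral_guess_le_of_sum_le_one hη hC (fun i : t.range => (hg i).const_mul N⁻¹)
    hsum t' (b := fun u => N⁻¹ * b u) fun i u => by
      rw [lintegral_const_mul' _ _ (ENNReal.inv_ne_top.2 hN0)]
      gcongr
      exact hb i u
  rw [lintegral_const_mul' _ _ (ENNReal.inv_ne_top.2 hN0),
    lintegral_const_mul' _ _ (ENNReal.inv_ne_top.2 hN0), mul_left_comm] at hscaled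
  exact (ENNReal.mul_le_mul_iff_right (ENNReal.inv_ne_zero.2 hNtop)
    (ENNReal.inv_ne_top.2 hN0)).1 hscaled

end Leakage

section SimpleSections

variable {α β : Type*} [MeasurableSpace α] [MeasurableSpace β]

/-- The subset of `β × α` with sections `c b`, where `c` takes finitely many values, all of them
measurable sets. Such sets form a ring generating the product `σ`-algebra, so they approximate all
measurable sets. -/
def simpleSectionSet (c : SimpleFunc β (Subtype (MeasurableSet : Set α → Prop))) : Set (β × α) :=
  {p | p.2 ∈ c p.1}

theorem measurableSet_simpleSectionSet
    (c : SimpleFunc β (Subtype (MeasurableSet : Set α → Prop))) :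
    MeasurableSet (simpleSectionSet c) :=
  SimpleFunc.measurableSet_cut (fun (p : β × α) s => p.2 ∈ s) (c.comp Prod.fst measurable_fst)
    fun s => (measurable_snd s.2 : MeasurableSet (Prod.snd ⁻¹' (s : Set α) : Set (β × α)))

theorem prod_mem_range_simpleSectionSet {t : Set β} {s : Set α} (ht : MeasurableSet t)
    (hs : MeasurableSet s) : t ×ˢ s ∈ Set.range (simpleSectionSet (α := α) (β := β)) := by
  classical
  refine ⟨SimpleFunc.piecewise t ht (SimpleFunc.const β ⟨s, hs⟩) (SimpleFunc.const β ∅), ?_⟩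
  ext ⟨b, a⟩
  by_cases hb : b ∈ t <;> simp [simpleSectionSet, hb, ← MeasurableSet.mem_coe]

theorem isSetRing_range_simpleSectionSet :
    IsSetRing (Set.range (simpleSectionSet (α := α) (β := β))) where
  empty_mem := ⟨SimpleFunc.const β ∅, by
    ext p; simp [simpleSectionSet, ← MeasurableSet.mem_coe]⟩
  union_mem := by
    rintro _ _ ⟨c, rfl⟩ ⟨c', rfl⟩
    exact ⟨(c.pair c').map fun s => s.1 ∪ s.2, rfl⟩
  sdiff_mem := by
    rintro _ _ ⟨c, rfl⟩ ⟨c', rfl⟩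
    exact ⟨(c.pair c').map fun s => s.1 \ s.2, rfl⟩

theorem generateFrom_range_simpleSectionSet :
    MeasurableSpace.generateFrom (Set.range (simpleSectionSet (α := α) (β := β))) =
      Prod.instMeasurableSpace := by
  refine le_antisymm (MeasurableSpace.generateFrom_le ?_) ?_
  · rintro _ ⟨c, rfl⟩
    exact measurableSet_simpleSectionSet c
  · rw [← generateFrom_prod]
    refine MeasurableSpace.generateFrom_mono ?_
    rintro _ ⟨t, ht, s, hs, rfl⟩
    exact prod_mem_range_simpleSectionSet ht hs

theorem exists_measure_simpleSectionSet_symmDiff_lt (m : Measure (β × α)) [IsFiniteMeasure m]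
    {S : Set (β × α)} (hS : MeasurableSet S) {ε : ℝ≥0∞} (hε : 0 < ε) :
    ∃ c, m (simpleSectionSet c ∆ S) < ε := by
  have huniv : Set.univ ∈ Set.range (simpleSectionSet (α := α) (β := β)) := by
    rw [← Set.univ_prod_univ]
    exact prod_mem_range_simpleSectionSet .univ .univ
  obtain ⟨_, ⟨c, rfl⟩, hc⟩ := exists_measure_symmDiff_lt_of_generateFrom_isSetRing
    (μ := m) isSetRing_range_simpleSectionSet
    ⟨{Set.univ}, Set.countable_singleton _, Set.singleton_subset_iff.2 huniv, by simp⟩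
    generateFrom_range_simpleSectionSet.symm hS hε
  exact ⟨c, hc⟩

theorem mul_measure_add_lt_section_le (m : Measure β) [SFinite m] (κ : Kernel β α)
    [IsSFiniteKernel κ] {S T : Set (β × α)} (hS : MeasurableSet S) (hT : MeasurableSet T)
    {f : β → ℝ≥0∞} (hf : ∀ᵐ b ∂m, κ b (Prod.mk b ⁻¹' S) ≤ f b) (δ : ℝ≥0∞) :
    δ * m {b | f b + δ < κ b (Prod.mk b ⁻¹' T)} ≤ (m ⊗ₘ κ) (T \ S) := by
  have hsub : m {b | f b + δ < κ b (Prod.mk b ⁻¹' T)} ≤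
      m {b | δ ≤ κ b (Prod.mk b ⁻¹' (T \ S))} := by
    refine measure_mono_ae ?_
    filter_upwards [hf] with b hb (hlt : f b + δ < κ b (Prod.mk b ⁻¹' T))
    have hadd : f b + δ < f b + κ b (Prod.mk b ⁻¹' (T \ S)) :=
      calc f b + δ < κ b (Prod.mk b ⁻¹' T) := hlt
        _ ≤ κ b (Prod.mk b ⁻¹' S) + κ b (Prod.mk b ⁻¹' (T \ S)) :=
          (measure_mono fun a ha => by
            by_cases haS : (b, a) ∈ S
            exacts [.inl haS, .inr ⟨ha, haS⟩]).trans (measure_union_le _ _)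
        _ ≤ f b + κ b (Prod.mk b ⁻¹' (T \ S)) := by gcongr
    exact (lt_of_add_lt_add_left hadd).le
  calc δ * m {b | f b + δ < κ b (Prod.mk b ⁻¹' T)}
      ≤ δ * m {b | δ ≤ κ b (Prod.mk b ⁻¹' (T \ S))} := by gcongr
    _ ≤ ∫⁻ b, κ b (Prod.mk b ⁻¹' (T \ S)) ∂m :=
        mul_meas_ge_le_lintegral (Kernel.measurable_kernel_prodMk_left (hT.diff hS)) δ
    _ = (m ⊗ₘ κ) (T \ S) := (Measure.compProd_apply (hT.diff hS)).symm

end SimpleSections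

section LeakageEvents

variable {𝓦 𝓧 𝓤 : Type*} [MeasurableSpace 𝓦] [MeasurableSpace 𝓧] [MeasurableSpace 𝓤]

/-- The law of `((X, U), W)`, where `μ` is the law of `(U, (W, X))`: what an informed guesser
observes comes first, the parameter last. -/
noncomputable def observationParamLaw (μ : Measure (𝓤 × (𝓦 × 𝓧))) : Measure ((𝓧 × 𝓤) × 𝓦) :=
  μ.map fun p => ((p.2.2, p.1), p.2.1)

theorem observationParamLaw_apply (μ : Measure (𝓤 × (𝓦 × 𝓧))) {S : Set ((𝓧 × 𝓤) × 𝓦)}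
    (hS : MeasurableSet S) :
    observationParamLaw μ S = μ {p | ((p.2.2, p.1), p.2.1) ∈ S} :=
  Measure.map_apply (by fun_prop) hS

instance isFiniteMeasure_observationParamLaw (μ : Measure (𝓤 × (𝓦 × 𝓧))) [IsFiniteMeasure μ] :
    IsFiniteMeasure (observationParamLaw μ) := by
  unfold observationParamLaw
  infer_instance

theorem snd_fst_observationParamLaw (μ : Measure (𝓤 × (𝓦 × 𝓧))) :
    (observationParamLaw μ).fst.snd = μ.fst := by
  rw [observationParamLaw, Measure.snd, Measure.fst, Measure.map_map (by fun_prop) (by fun_prop),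
    Measure.map_map (by fun_prop) (by fun_prop)]
  rfl

theorem observationParamLaw_simpleSectionSet_le {μ : Measure (𝓤 × (𝓦 × 𝓧))} [IsFiniteMeasure μ]
    {η : Kernel 𝓤 𝓦} [IsMarkovKernel η] (hη : IsCondLawOfParam μ η)
    (hC : condMaxLeakage μ ≠ ⊤) (c : SimpleFunc (𝓧 × 𝓤) (Subtype (MeasurableSet : Set 𝓦 → Prop)))
    {b : 𝓤 → ℝ≥0∞} (hb : Measurable b) :
    observationParamLaw μ (simpleSectionSet c ∩ {p | η p.1.2 (c p.1) ≤ b p.1.2}) ≤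
      EReal.exp (condMaxLeakage μ) * ∫⁻ u, b u ∂μ.fst := by
  let G (s : Subtype (MeasurableSet : Set 𝓦 → Prop)) : Set (𝓤 × 𝓦) :=
    {a | a.2 ∈ s ∧ η a.1 s ≤ b a.1}
  have hG (s) : MeasurableSet (G s) :=
    (measurable_snd s.2).inter (measurableSet_le
      ((η.measurable_coe s.2).comp measurable_fst) (hb.comp measurable_fst))
  have hGb (s u) : ∫⁻ w, (G s).indicator 1 (u, w) ∂(η u) ≤ b u := by
    change ∫⁻ w, (Prod.mk u ⁻¹' G s).indicator 1 w ∂(η u) ≤ b u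
    rw [lintegral_indicator_one (measurable_prodMk_left (hG s))]
    by_cases hs : η u s ≤ b u
    · exact (measure_mono fun w hw => hw.1).trans hs
    · simp [G, hs]
  have hevent : MeasurableSet (simpleSectionSet c ∩ {p | η p.1.2 (c p.1) ≤ b p.1.2}) :=
    SimpleFunc.measurableSet_cut (fun (p : (𝓧 × 𝓤) × 𝓦) s => (p.1.2, p.2) ∈ G s)
      (c.comp Prod.fst measurable_fst) fun s => (by fun_prop : Measurable _) (hG s)
  rw [← lintegral_indicator_one hevent, observationParamLaw,
    lintegral_map (measurable_one.indicator hevent) (by fun_prop)]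
  exact lintegral_guess_le_of_le_one hη hC (fun s => measurable_one.indicator (hG s))
    (fun s a => Set.indicator_le_self' (fun _ _ => zero_le) a) c hGb

theorem observationParamLaw_le_of_approx {μ : Measure (𝓤 × (𝓦 × 𝓧))} [IsFiniteMeasure μ]
    {η : Kernel 𝓤 𝓦} [IsMarkovKernel η] (hη : IsCondLawOfParam μ η)
    (hC : condMaxLeakage μ ≠ ⊤) {S : Set ((𝓧 × 𝓤) × 𝓦)} (hS : MeasurableSet S)
    {L : 𝓤 → ℝ≥0∞} (hL : Measurable L)
    (hSL : ∀ᵐ q ∂(observationParamLaw μ).fst, η q.2 (Prod.mk q ⁻¹' S) ≤ L q.2)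
    {δ : ℝ≥0∞} (hδ0 : δ ≠ 0) (hδtop : δ ≠ ⊤) :
    observationParamLaw μ S ≤ δ * δ +
      (EReal.exp (condMaxLeakage μ) * (∫⁻ u, L u ∂μ.fst + δ * μ.fst Set.univ) + δ) := by
  set lam := observationParamLaw μ
  let η' : Kernel (𝓧 × 𝓤) 𝓦 := η.comap Prod.snd measurable_snd
  obtain ⟨c, hc⟩ := exists_measure_simpleSectionSet_symmDiff_lt (lam + lam.fst ⊗ₘ η') hS
    (ENNReal.mul_pos hδ0 hδ0)
  have hT := measurableSet_simpleSectionSet c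
  set T := simpleSectionSet c
  rw [Measure.add_apply] at hc
  have hmissed : lam (S \ T) ≤ δ * δ :=
    (measure_mono Set.subset_union_right).trans (le_self_add.trans hc.le)
  have hadded : (lam.fst ⊗ₘ η') (T \ S) ≤ δ * δ :=
    (measure_mono Set.subset_union_left).trans (le_add_self.trans hc.le)
  let D : Set (𝓧 × 𝓤) := {q | L q.2 + δ < η' q (Prod.mk q ⁻¹' T)}
  have hD : MeasurableSet D :=
    measurableSet_lt ((hL.comp measurable_snd).add_const δ)
      (Kernel.measurable_kernel_prodMk_left hT)
  have hexcess : lam (Prod.fst ⁻¹' D) ≤ δ := by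
    rw [← Measure.fst_apply hD]
    exact (ENNReal.mul_le_mul_iff_right hδ0 hδtop).1
      ((mul_measure_add_lt_section_le lam.fst η' hS hT hSL δ).trans hadded)
  have hregular := observationParamLaw_simpleSectionSet_le hη hC c (hL.add_const δ)
  rw [lintegral_add_right _ measurable_const, lintegral_const] at hregular
  have hcover : S ⊆ (S \ T) ∪ ((T ∩ {p | η p.1.2 (c p.1) ≤ L p.1.2 + δ}) ∪ Prod.fst ⁻¹' D) := by
    intro p hp
    by_cases hpT : p ∈ T
    · rcases le_or_gt (η p.1.2 (c p.1)) (L p.1.2 + δ) with hle | hlt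
      exacts [.inr (.inl ⟨hpT, hle⟩), .inr (.inr hlt)]
    · exact .inl ⟨hp, hpT⟩
  exact (measure_mono hcover).trans <| (measure_union_le _ _).trans <|
    add_le_add hmissed <| (measure_union_le _ _).trans (add_le_add hregular hexcess)

theorem observationParamLaw_le_exp_condMaxLeakage_mul {μ : Measure (𝓤 × (𝓦 × 𝓧))}
    [IsFiniteMeasure μ] {η : Kernel 𝓤 𝓦} [IsMarkovKernel η] (hη : IsCondLawOfParam μ η)
    (hC : condMaxLeakage μ ≠ ⊤) {S : Set ((𝓧 × 𝓤) × 𝓦)} (hS : MeasurableSet S)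
    {L : 𝓤 → ℝ≥0∞} (hL : Measurable L)
    (hSL : ∀ᵐ q ∂(observationParamLaw μ).fst, η q.2 (Prod.mk q ⁻¹' S) ≤ L q.2) :
    observationParamLaw μ S ≤ EReal.exp (condMaxLeakage μ) * ∫⁻ u, L u ∂μ.fst := by
  set C := EReal.exp (condMaxLeakage μ)
  have hCtop : C ≠ ⊤ := by simpa [C] using hC
  have hδ : Tendsto id (𝓝[>] (0 : ℝ≥0∞)) (𝓝 0) := tendsto_id.mono_left nhdsWithin_le_nhds
  have hlim : Tendsto
      (fun δ : ℝ≥0∞ => δ * δ + (C * (∫⁻ u, L u ∂μ.fst + δ * μ.fst Set.univ) + δ)) (𝓝[>] 0)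
      (𝓝 (0 * 0 + (C * (∫⁻ u, L u ∂μ.fst + 0 * μ.fst Set.univ) + 0))) :=
    (ENNReal.Tendsto.mul hδ (.inr ENNReal.zero_ne_top) hδ (.inr ENNReal.zero_ne_top)).add
      ((ENNReal.Tendsto.const_mul (tendsto_const_nhds.add
        (ENNReal.Tendsto.mul_const hδ (.inr (measure_ne_top _ _)))) (.inr hCtop)).add hδ)
  simp only [zero_mul, add_zero, zero_add] at hlim
  refine ge_of_tendsto hlim ?_
  filter_upwards [Ioo_mem_nhdsGT ENNReal.zero_lt_top] with δ hδ
  exact observationParamLaw_le_of_approx hη hC hS hL hSL hδ.1.ne' hδ.2.ne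

theorem measure_le_exp_condMaxLeakage_add_log {μ : Measure (𝓤 × (𝓦 × 𝓧))} [IsFiniteMeasure μ]
    {η : Kernel 𝓤 𝓦} [IsMarkovKernel η] (hη : IsCondLawOfParam μ η)
    {S : Set (𝓤 × (𝓦 × 𝓧))} (hS : MeasurableSet S) {L : 𝓤 → ℝ≥0∞} (hL : AEMeasurable L μ.fst)
    (hSL : ∀ᵐ u ∂μ.fst, ∀ x, η u {w | (u, (w, x)) ∈ S} ≤ L u)
    (h : condMaxLeakage μ ≠ ⊤ ∨ ∫⁻ u, L u ∂μ.fst ≠ 0) :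
    μ S ≤ EReal.exp (condMaxLeakage μ + ENNReal.log (∫⁻ u, L u ∂μ.fst)) := by
  rcases eq_or_ne (condMaxLeakage μ) ⊤ with htop | htop
  · have h0 : ∫⁻ u, L u ∂μ.fst ≠ 0 := h.resolve_left (not_not.2 htop)
    rw [htop, EReal.top_add_of_ne_bot (by simpa using h0), EReal.exp_top]
    exact le_top
  · have hS' : MeasurableSet {q : (𝓧 × 𝓤) × 𝓦 | (q.1.2, (q.2, q.1.1)) ∈ S} :=
      (by fun_prop : Measurable fun q : (𝓧 × 𝓤) × 𝓦 => (q.1.2, (q.2, q.1.1))) hS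
    have hSL' : ∀ᵐ u ∂(observationParamLaw μ).fst.snd,
        ∀ x, η u {w | (u, (w, x)) ∈ S} ≤ hL.mk L u := by
      rw [snd_fst_observationParamLaw]
      filter_upwards [hSL, hL.ae_eq_mk] with u hu hLu x
      exact hLu ▸ hu x
    rw [EReal.exp_add, ENNReal.exp_log, lintegral_congr_ae hL.ae_eq_mk]
    refine (observationParamLaw_apply μ hS').symm.trans_le
      (observationParamLaw_le_exp_condMaxLeakage_mul hη htop hS' hL.measurable_mk ?_)
    filter_upwards [ae_of_ae_map measurable_snd.aemeasurable hSL'] with q hq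
    exact hq q.1

end LeakageEvents

section BayesRisk

variable {𝓦 𝓧 𝓦' 𝓤 : Type*} [MeasurableSpace 𝓦] [MeasurableSpace 𝓤]

/-- The event, in the space of pairs `(W, X)`, that the estimator `φ` has loss less than `ρ`. -/
def smallLossEvent (ℓ : 𝓦 → 𝓦' → ℝ≥0) (ρ : ℝ) (φ : 𝓧 → 𝓦') : Set (𝓦 × 𝓧) :=
  {p | (ℓ p.1 (φ p.2) : ℝ) < ρ}

theorem section_smallLossEvent_le_condSmallBall (η : Kernel 𝓤 𝓦) (ℓ : 𝓦 → 𝓦' → ℝ≥0) (ρ : ℝ)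
    (φ : 𝓧 → 𝓦') (u : 𝓤) (x : 𝓧) :
    η u {w | (w, x) ∈ smallLossEvent ℓ ρ φ} ≤ condSmallBall η ℓ ρ u :=
  le_iSup (fun w' => η u {w | (ℓ w w' : ℝ) < ρ}) (φ x)

theorem lintegral_condSmallBall_ne_top (m : Measure 𝓤) [IsFiniteMeasure m] (η : Kernel 𝓤 𝓦)
    [IsMarkovKernel η] (ℓ : 𝓦 → 𝓦' → ℝ≥0) (ρ : ℝ) : ∫⁻ u, condSmallBall η ℓ ρ u ∂m ≠ ⊤ :=
  (IsFiniteMeasure.lintegral_lt_top_of_bounded_to_ennreal m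
    ⟨1, fun _ => iSup_le fun _ => prob_le_one⟩).ne

variable [MeasurableSpace 𝓧]

theorem measurableSet_smallLossEvent [MeasurableSpace 𝓦'] {ℓ : 𝓦 → 𝓦' → ℝ≥0}
    (hℓ : Measurable (Function.uncurry ℓ)) (ρ : ℝ) {φ : 𝓧 → 𝓦'} (hφ : Measurable φ) :
    MeasurableSet (smallLossEvent ℓ ρ φ) :=
  measurableSet_lt (measurable_coe_nnreal_real.comp
    (hℓ.comp (measurable_fst.prodMk (hφ.comp measurable_snd)))) measurable_const

theorem mul_one_sub_measure_lt_le_lintegral {E : Type*} [MeasurableSpace E] (μ : Measure E)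
    [IsProbabilityMeasure μ] {f : E → ℝ≥0∞} (hf : Measurable f) (c : ℝ≥0∞) :
    c * (1 - μ {e | f e < c}) ≤ ∫⁻ e, f e ∂μ := by
  rw [← prob_compl_eq_one_sub (measurableSet_lt hf measurable_const)]
  simpa only [Set.compl_ofPred, not_lt] using mul_meas_ge_le_lintegral hf c

theorem ofReal_mul_one_sub_le_bayesianRisk [MeasurableSpace 𝓦'] (π : Measure 𝓦)
    [IsProbabilityMeasure π] (P : Kernel 𝓦 𝓧) [IsMarkovKernel P] {ℓ : 𝓦 → 𝓦' → ℝ≥0}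
    (hℓ : Measurable (Function.uncurry ℓ)) (ρ : ℝ) {x : ℝ≥0∞}
    (hx : ∀ φ : 𝓧 → 𝓦', Measurable φ → (π ⊗ₘ P) (smallLossEvent ℓ ρ φ) ≤ x) :
    ENNReal.ofReal ρ * (1 - x) ≤ bayesianRisk π P ℓ := by
  refine le_iInf₂ fun φ hφ => ?_
  have hevent : smallLossEvent ℓ ρ φ =
      {p | (ℓ p.1 (φ p.2) : ℝ≥0∞) < ENNReal.ofReal ρ} := by
    ext p
    simp [smallLossEvent, ENNReal.lt_ofReal_iff_toReal_lt]
  have hloss : Measurable fun p : 𝓦 × 𝓧 => (ℓ p.1 (φ p.2) : ℝ≥0∞) :=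
    measurable_coe_nnreal_ennreal.comp
      (hℓ.comp (measurable_fst.prodMk (hφ.comp measurable_snd)))
  calc ENNReal.ofReal ρ * (1 - x)
      ≤ ENNReal.ofReal ρ * (1 - (π ⊗ₘ P) (smallLossEvent ℓ ρ φ)) := by
        gcongr
        exact hx φ hφ
    _ ≤ ∫⁻ p, (ℓ p.1 (φ p.2) : ℝ≥0∞) ∂(π ⊗ₘ P) :=
        hevent ▸ mul_one_sub_measure_lt_le_lintegral _ hloss _

theorem coe_mul_one_sub_le_coe_ofReal_mul_one_sub {ρ : ℝ} (hρ : 0 ≤ ρ) (x : ℝ≥0∞) :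
    (ρ : EReal) * (1 - (x : EReal)) ≤ ((ENNReal.ofReal ρ * (1 - x) : ℝ≥0∞) : EReal) := by
  have hsub : 1 - (x : EReal) ≤ ((1 - x : ℝ≥0∞) : EReal) :=
    EReal.sub_le_of_le_add (by exact_mod_cast le_tsub_add)
  rw [EReal.coe_ennreal_mul, EReal.coe_ennreal_ofReal, max_eq_left hρ]
  exact mul_le_mul_of_nonneg_left hsub (by exact_mod_cast hρ)

instance isProbabilityMeasure_jointLaw (π : Measure 𝓦) [IsProbabilityMeasure π] (P : Kernel 𝓦 𝓧)
    [IsMarkovKernel P] (κ : Kernel (𝓦 × 𝓧) 𝓤) [IsMarkovKernel κ] :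
    IsProbabilityMeasure (jointLaw π P κ) :=
  Measure.isProbabilityMeasure_map measurable_swap.aemeasurable

theorem snd_jointLaw (π : Measure 𝓦) (P : Kernel 𝓦 𝓧) (κ : Kernel (𝓦 × 𝓧) 𝓤)
    [IsMarkovKernel κ] : (jointLaw π P κ).snd = π ⊗ₘ P := by
  rw [jointLaw, Measure.snd_map_swap, Measure.fst_compProd]

theorem coe_mul_one_sub_le_bayesianRisk [MeasurableSpace 𝓦'] (π : Measure 𝓦)
    [IsProbabilityMeasure π] (P : Kernel 𝓦 𝓧) [IsMarkovKernel P] (κ : Kernel (𝓦 × 𝓧) 𝓤)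
    [IsMarkovKernel κ] {ℓ : 𝓦 → 𝓦' → ℝ≥0} (hℓ : Measurable (Function.uncurry ℓ))
    {ρ : ℝ} (hρ : 0 ≤ ρ) {x : ℝ≥0∞}
    (hx : ∀ φ : 𝓧 → 𝓦', Measurable φ →
      jointLaw π P κ (Prod.snd ⁻¹' smallLossEvent ℓ ρ φ) ≤ x) :
    (ρ : EReal) * (1 - (x : EReal)) ≤ (bayesianRisk π P ℓ : EReal) := by
  refine (coe_mul_one_sub_le_coe_ofReal_mul_one_sub hρ x).trans
    (EReal.coe_ennreal_le_coe_ennreal_iff.2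
      (ofReal_mul_one_sub_le_bayesianRisk π P hℓ ρ fun φ hφ => ?_))
  rw [← snd_jointLaw π P κ, Measure.snd_apply (measurableSet_smallLossEvent hℓ ρ hφ)]
  exact hx φ hφ

end BayesRisk

theorem mainTheorem6 {𝓦 𝓧 𝓦' 𝓤 : Type*} [MeasurableSpace 𝓦] [MeasurableSpace 𝓧]
    [MeasurableSpace 𝓦'] [MeasurableSpace 𝓤]
    (π : Measure 𝓦) [IsProbabilityMeasure π] (P : Kernel 𝓦 𝓧) [IsMarkovKernel P]
    (ℓ : 𝓦 → 𝓦' → ℝ≥0) (hℓ : Measurable (Function.uncurry ℓ))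
    (κ : Kernel (𝓦 × 𝓧) 𝓤) [IsMarkovKernel κ]
    (η : Kernel 𝓤 𝓦) [IsMarkovKernel η] (hη : IsCondLawOfParam (jointLaw π P κ) η)
    (ρ : ℝ) (hρ : 0 < ρ)
    (hL : AEMeasurable (condSmallBall η ℓ ρ) (jointLaw π P κ).fst) :
    (∀ α : ℝ, 1 ≤ α →
      (condSibson α (jointLaw π P κ) η ≠ ⊤ ∨
        ∫⁻ u, condSmallBall η ℓ ρ u ∂(jointLaw π P κ).fst ≠ 0) →
      (ρ : EReal) * (1 - (EReal.exp ((((α - 1) / α : ℝ) : EReal) *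
          (condSibson α (jointLaw π P κ) η +
            ENNReal.log (∫⁻ u, condSmallBall η ℓ ρ u ∂(jointLaw π P κ).fst))) : EReal))
        ≤ (bayesianRisk π P ℓ : EReal)) ∧
    ((condMaxLeakage (jointLaw π P κ) ≠ ⊤ ∨
        ∫⁻ u, condSmallBall η ℓ ρ u ∂(jointLaw π P κ).fst ≠ 0) →
      (ρ : EReal) * (1 - (EReal.exp (condMaxLeakage (jointLaw π P κ) +
            ENNReal.log (∫⁻ u, condSmallBall η ℓ ρ u ∂(jointLaw π P κ).fst)) : EReal))
        ≤ (bayesianRisk π P ℓ : EReal)) := by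
  have hevent (φ : 𝓧 → 𝓦') (hφ : Measurable φ) :
      MeasurableSet (Prod.snd ⁻¹' smallLossEvent ℓ ρ φ : Set (𝓤 × (𝓦 × 𝓧))) :=
    measurable_snd (measurableSet_smallLossEvent hℓ ρ hφ)
  have hsection (φ : 𝓧 → 𝓦') := ae_of_all (jointLaw π P κ).fst
    (section_smallLossEvent_le_condSmallBall η ℓ ρ φ)
  refine ⟨fun α hα h => ?_, fun h => ?_⟩
  · exact coe_mul_one_sub_le_bayesianRisk π P κ hℓ hρ.le fun φ hφ =>
      measure_le_exp_condSibson_add_log _ η hα (hevent φ hφ)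
        (lintegral_condSmallBall_ne_top _ η ℓ ρ) (hsection φ) h
  · exact coe_mul_one_sub_le_bayesianRisk π P κ hℓ hρ.le fun φ hφ =>
      measure_le_exp_condMaxLeakage_add_log hη (hevent φ hφ) hL (hsection φ) h
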